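/- All graphs are finite and simple. Let $G$ be a graph with vertex set $V(G)$. Given a set $B\subseteq V(G)$ of blue vertices (the others being white), the PSD color change rule allows a blue vertex $u$ to change a white vertex $w$ to blue if $w$ is the only neighbor of $u$ in the connected component of $G[V(G)\setminus B]$ that contains $w$. A set $S\subseteq V(G)$ is a PSD (zero) forcing set of $G$ if, starting with exactly the vertices of $S$ blue, repeated application of this rule colors all of $V(G)$ blue. The PSD forcing TAR graph $\mathfrak{Z}^+(G)$ has the PSD forcing sets of $G$ as its vertices, and $S_1,S_2$ are adjacent if and only if $|S_1\ominus S_2|=1$, where $\ominus$ denotes symmetric difference. For every integer $q\ge 2$, the PSD forcing TAR graph of the complete bipartite graph $K_{2,q}$ (which has no isolated vertices) is unique; that is, if $G$ is a graph with no isolated vertices and $\mathfrak{Z}^+(G)\cong\mathfrak{Z}^+(K_{2,q})$, then $G\cong K_{2,q}$. -/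

import Mathlib

universe u v

/-- The PSD color change rule: with blue set `B`, the blue vertex `u` can color the white vertex `w`
blue if `w` is the only neighbor of `u` in the connected component of `w` in `G[V ∖ B]`. -/
def PSDForces {V : Type u} (G : SimpleGraph V) (B : Set V) (u w : V) : Prop :=
  u ∈ B ∧ G.Adj u w ∧ ∃ hw : w ∈ Bᶜ, ∀ x : ↥(Bᶜ),
    (G.induce Bᶜ).Reachable ⟨w, hw⟩ x → G.Adj u x → (x : V) = w

/-- One application of the PSD color change rule turns the blue set `B` into `B'`. -/
def PSDStep {V : Type u} (G : SimpleGraph V) (B B' : Set V) : Prop :=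
  ∃ u w : V, PSDForces G B u w ∧ B' = insert w B

/-- `T` is a PSD final coloring of `S`: it arises from `S` by repeated applications of the
PSD color change rule, and no further change is possible. -/
def IsPSDFinalColoring {V : Type u} (G : SimpleGraph V) (S T : Set V) : Prop :=
  Relation.ReflTransGen (PSDStep G) S T ∧ ∀ T' : Set V, ¬ PSDStep G T T'

/-- `S` is a PSD zero forcing set of `G`. -/
def IsPSDForcingSet {V : Type u} (G : SimpleGraph V) (S : Set V) : Prop :=
  IsPSDFinalColoring G S Set.univ

/-- The PSD forcing TAR graph of `G`: its vertices are the PSD zero forcing sets of `G`, and two are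
adjacent when their symmetric difference has exactly one element. -/
def psdTARGraph {V : Type u} (G : SimpleGraph V) :
    SimpleGraph {S : Set V // IsPSDForcingSet G S} where
  Adj S T := (symmDiff (S : Set V) (T : Set V)).ncard = 1
  symm := ⟨fun S T h => by rwa [symmDiff_comm]⟩
  loopless := ⟨fun S h => by simp at h⟩

/-- `H` (a graph without isolated vertices) has a unique PSD forcing TAR graph: every finite graph
`G` without isolated vertices whose TAR graph is isomorphic to that of `H` is isomorphic to `H`. -/
def HasUniquePSDTARGraph {W : Type v} (H : SimpleGraph W) : Prop :=
  (∀ w : W, ¬ H.IsIsolated w) ∧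
    ∀ (V : Type u) [Finite V] (G : SimpleGraph V), (∀ x : V, ¬ G.IsIsolated x) →
      Nonempty (psdTARGraph G ≃g psdTARGraph H) → Nonempty (G ≃g H)

/-!
The full vertex set and its subsets missing one vertex are PSD forcing, and every edge of a TAR
graph carries as label the vertex in which its ends differ. Opposite edges of a square have equal
labels, so an isomorphism of TAR graphs sends the complement of `R` to `A ∆ π(R)` for a fixed set
`A` and a bijection `π` of the vertices. Since the forcing sets form upper sets, `π` alone already
maps the forcing sets of one graph onto those of the other.

It remains to recognise `K_{2,q}` by its forcing sets: the sets that are not forcing are exactly the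
proper subsets of its two parts. If the corresponding partition of `G` into `{a, b}` and `Q` has
`a` and `b` not adjacent, then every `{a, b, k}` with `k ∈ Q` is a fort, so `k` is adjacent to both
`a` and `b`, and `Q` is independent because `{a, b}` is forcing. If `a` and `b` are adjacent, then
forcing from `Q` and from `{a, b}` leaves only `|Q| = 2` and the 4-cycle `K_{2,2}`.
-/

section Forcing

variable {V : Type u} {G : SimpleGraph V} {B F S T : Set V} {c u w x : V}

theorem PSDForces.eq_of_reachable (h : PSDForces G B u w) (hw : w ∈ Bᶜ) (hx : x ∈ Bᶜ)
    (hwx : (G.induce Bᶜ).Reachable ⟨w, hw⟩ ⟨x, hx⟩) (hux : G.Adj u x) : x = w := by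
  obtain ⟨-, -, _, hunique⟩ := h
  exact hunique ⟨x, hx⟩ hwx hux

theorem PSDForces.notMem (h : PSDForces G B u w) : w ∉ B :=
  h.2.2.1

theorem PSDForces.not_adj (h : PSDForces G B u w) (hx : x ∉ B) (hux : G.Adj u x) :
    ¬ G.Adj w x := fun hwx =>
  hwx.ne' (h.eq_of_reachable h.notMem hx (SimpleGraph.Adj.reachable (by simpa using hwx)) hux)

theorem PSDForces.mono (h : PSDForces G B u w) (hBS : B ⊆ S) (hw : w ∉ S) :
    PSDForces G S u w := by
  have hle : Sᶜ ⊆ Bᶜ := Set.compl_subset_compl.2 hBS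
  exact ⟨hBS h.1, h.2.1, hw, fun x hwx hux =>
    h.eq_of_reachable (hle hw) (hle x.2) (hwx.map (SimpleGraph.induceHomOfLE G hle).toHom) hux⟩

theorem psdForces_of_forall_not_adj (hu : u ∈ B) (huw : G.Adj u w) (hw : w ∉ B)
    (h : ∀ x ∉ B, ¬ G.Adj w x) : PSDForces G B u w := by
  refine ⟨hu, huw, hw, fun x ⟨p⟩ _ => ?_⟩
  cases p with
  | nil => rfl
  | @cons _ y _ hwy _ => exact absurd (by simpa using hwy) (h y y.2)

theorem psdForces_of_forall_adj_eq (hu : u ∈ B) (huw : G.Adj u w) (hw : w ∉ B)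
    (h : ∀ x ∉ B, G.Adj u x → x = w) : PSDForces G B u w :=
  ⟨hu, huw, hw, fun x _ hux => h x x.2 hux⟩

theorem isPSDForcingSet_iff_reflTransGen :
    IsPSDForcingSet G S ↔ Relation.ReflTransGen (PSDStep G) S Set.univ := by
  refine ⟨And.left, fun h => ⟨h, ?_⟩⟩
  rintro _ ⟨u, w, hf, -⟩
  exact hf.notMem (Set.mem_univ w)

theorem isPSDForcingSet_univ : IsPSDForcingSet G Set.univ :=
  isPSDForcingSet_iff_reflTransGen.2 .refl

theorem PSDForces.isPSDForcingSet (hf : PSDForces G S u w)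
    (h : IsPSDForcingSet G (insert w S)) : IsPSDForcingSet G S :=
  isPSDForcingSet_iff_reflTransGen.2
    (.head ⟨u, w, hf, rfl⟩ (isPSDForcingSet_iff_reflTransGen.1 h))

theorem IsPSDForcingSet.mono (hS : IsPSDForcingSet G S) (hST : S ⊆ T) :
    IsPSDForcingSet G T := by
  have hreach : ∀ R, Relation.ReflTransGen (PSDStep G) S R →
      ∃ R', R ⊆ R' ∧ Relation.ReflTransGen (PSDStep G) T R' := by
    intro R hR
    induction hR with
    | refl => exact ⟨T, hST, .refl⟩
    | tail _ hstep ih =>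
      obtain ⟨R', hRR', hTR'⟩ := ih
      obtain ⟨u, w, hf, rfl⟩ := hstep
      by_cases hw : w ∈ R'
      · exact ⟨R', Set.insert_subset hw hRR', hTR'⟩
      · exact ⟨insert w R', Set.insert_subset_insert hRR',
          hTR'.tail ⟨u, w, hf.mono hRR' hw, rfl⟩⟩
  obtain ⟨R', hR', hTR'⟩ := hreach _ hS.1
  exact isPSDForcingSet_iff_reflTransGen.2 (Set.univ_subset_iff.1 hR' ▸ hTR')

/-- A PSD fort is a nonempty set `F` such that no force is possible when exactly the vertices of
`F` are white. Forts are the obstructions to PSD forcing: see `isPSDForcingSet_iff_forall_fort`. -/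
def IsPSDFort (G : SimpleGraph V) (F : Set V) : Prop :=
  F.Nonempty ∧ ∀ u w, ¬ PSDForces G Fᶜ u w

theorem IsPSDFort.exists_adj (hF : IsPSDFort G F) (hwF : w ∈ F) (hw : ¬ G.IsIsolated w) :
    ∃ x ∈ F, G.Adj w x := by
  by_contra! hiso
  obtain ⟨u, hwu⟩ := SimpleGraph.exists_adj_iff_not_isIsolated.2 hw
  exact hF.2 u w (psdForces_of_forall_not_adj (fun hu => hiso u hu hwu) hwu.symm
    (not_not.2 hwF) fun x hx => hiso x (not_not.1 hx))

theorem IsPSDFort.exists_ne_adj (hF : IsPSDFort G F) (hu : u ∉ F) (hw : w ∈ F)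
    (huw : G.Adj u w) : ∃ x ∈ F, x ≠ w ∧ G.Adj u x := by
  by_contra! h
  exact hF.2 u w (psdForces_of_forall_adj_eq hu huw (not_not.2 hw)
    fun x hx hux => by_contra fun hxw => h x (not_not.1 hx) hxw hux)

theorem isPSDFort_compl_of_maximal (hS : Maximal (fun T => ¬ IsPSDForcingSet G T) S) :
    IsPSDFort G Sᶜ := by
  refine ⟨Set.nonempty_compl.2 fun h => hS.prop (h ▸ isPSDForcingSet_univ), fun u w hf => ?_⟩
  rw [compl_compl] at hf
  have hinsert : ¬ IsPSDForcingSet G (insert w S) := mt hf.isPSDForcingSet hS.prop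
  exact hf.notMem (hS.le_of_ge hinsert (Set.subset_insert w S) (Set.mem_insert w S))

theorem IsPSDForcingSet.not_disjoint_fort (hS : IsPSDForcingSet G S) (hF : IsPSDFort G F) :
    ¬ Disjoint S F := by
  intro hSF
  obtain ⟨x, hx⟩ := hF.1
  have hFc : IsPSDForcingSet G Fᶜ := hS.mono hSF.subset_compl_right
  rcases hFc.1.cases_head with heq | ⟨_, ⟨u, w, hf, -⟩, -⟩
  · exact heq.ge (Set.mem_univ x) hx
  · exact hF.2 u w hf

theorem isPSDForcingSet_iff_forall_fort [Finite V] :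
    IsPSDForcingSet G S ↔ ∀ F, IsPSDFort G F → ¬ Disjoint S F := by
  refine ⟨fun hS F => hS.not_disjoint_fort, fun h => by_contra fun hS => ?_⟩
  obtain ⟨T, hST, hT⟩ := Finite.exists_le_maximal (p := fun T => ¬ IsPSDForcingSet G T) hS
  exact h _ (isPSDFort_compl_of_maximal hT) (Set.disjoint_compl_right_iff_subset.2 hST)

theorem isPSDForcingSet_of_isIndepSet_compl [Finite V] (hG : ∀ x, ¬ G.IsIsolated x)
    (hS : G.IsIndepSet Sᶜ) : IsPSDForcingSet G S := by
  refine isPSDForcingSet_iff_forall_fort.2 fun F hF hSF => ?_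
  obtain ⟨w, hw⟩ := hF.1
  obtain ⟨x, hx, hwx⟩ := hF.exists_adj hw (hG w)
  exact hS (hSF.subset_compl_left hw) (hSF.subset_compl_left hx) hwx.ne hwx

theorem IsPSDForcingSet.exists_existsUnique_adj (hS : IsPSDForcingSet G S) (hSF : Disjoint S F)
    (hF : (G.induce F).Connected) : ∃ u ∉ F, ∃! w, w ∈ F ∧ G.Adj u w := by
  have hnot : ¬ IsPSDFort G F := fun h => hS.not_disjoint_fort h hSF
  have hne : F.Nonempty := Set.nonempty_coe_sort.1 hF.nonempty
  simp only [IsPSDFort, hne, true_and, not_forall, not_not] at hnot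
  obtain ⟨u, w, hf⟩ := hnot
  obtain ⟨B, rfl⟩ := compl_surjective F
  rw [compl_compl] at hf
  exact ⟨u, not_not.2 hf.1, w, ⟨hf.notMem, hf.2.1⟩, fun x ⟨hx, hux⟩ =>
    hf.eq_of_reachable hf.notMem hx (hF.preconnected _ _) hux⟩

theorem connected_induce_of_forall_adj (hc : c ∈ F) (h : ∀ x ∈ F, x ≠ c → G.Adj c x) :
    (G.induce F).Connected :=
  .of_isUniversal (v := ⟨c, hc⟩) fun x hx => h x x.2 fun h => hx (Subtype.ext h.symm)

end Forcing

section TAR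

variable {V : Type u} {W : Type v} {𝓕 : Set (Set V)} {𝓖 : Set (Set W)}

/-- The token addition and removal graph of a family `𝓕` of sets. For the family of PSD forcing
sets of a graph `G` it is `psdTARGraph G`, by definition. -/
def tarGraph (𝓕 : Set (Set V)) : SimpleGraph 𝓕 where
  Adj S T := (symmDiff (S : Set V) (T : Set V)).ncard = 1
  symm := ⟨fun S T h => by rwa [symmDiff_comm]⟩
  loopless := ⟨fun S h => by simp at h⟩

theorem tarGraph_adj_iff {S T : 𝓕} :
    (tarGraph 𝓕).Adj S T ↔ ∃ x, (T : Set V) = symmDiff (S : Set V) {x} := by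
  refine Set.ncard_eq_one.trans (exists_congr fun x => ⟨fun h => ?_, fun h => ?_⟩)
  · rw [← h, symmDiff_symmDiff_cancel_left]
  · rw [h, symmDiff_symmDiff_cancel_left]

theorem symmDiff_singleton_of_notMem {S : Set V} {x : V} (hx : x ∉ S) :
    symmDiff S {x} = insert x S := by
  rw [(Set.disjoint_singleton_right.2 hx).symmDiff_eq_sup]
  exact Set.union_singleton

theorem tarGraph_adj_compl_insert {R : Set V} {x : V} (hx : x ∉ R) (hR : Rᶜ ∈ 𝓕)
    (hxR : (insert x R)ᶜ ∈ 𝓕) : (tarGraph 𝓕).Adj ⟨Rᶜ, hR⟩ ⟨(insert x R)ᶜ, hxR⟩ := by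
  change (symmDiff Rᶜ (insert x R)ᶜ).ncard = 1
  rw [compl_symmDiff_compl, ← symmDiff_singleton_of_notMem hx, symmDiff_symmDiff_cancel_left,
    Set.ncard_singleton]

theorem eq_or_eq_of_symmDiff_singleton_eq {A C : Set V} {x y z t : V} (hxy : x ≠ y)
    (hxz : C = symmDiff (symmDiff A {x}) {z}) (hyt : C = symmDiff (symmDiff A {y}) {t}) :
    C = A ∨ C = symmDiff (symmDiff A {x}) {y} := by
  by_cases hzx : z = x
  · exact .inl (by rw [hxz, hzx, symmDiff_symmDiff_cancel_right])
  · have hpair : symmDiff ({x} : Set V) {z} = symmDiff {y} {t} := by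
      rw [symmDiff_assoc] at hxz hyt
      exact symmDiff_right_injective A (hxz.symm.trans hyt)
    have hzy : z = y := by
      have hx := Set.ext_iff.1 hpair x
      have hz := Set.ext_iff.1 hpair z
      simp only [Set.mem_symmDiff, Set.mem_singleton_iff] at hx hz
      grind
    exact .inr (by rw [hxz, hzy])

theorem map_compl_insert_eq_symmDiff_singleton (h𝓕 : IsUpperSet 𝓕)
    {f : tarGraph 𝓕 →g tarGraph 𝓖} (hf : Function.Injective f) {π : V → W}
    (hπ : Function.Injective π) (hempty : ∅ᶜ ∈ 𝓕)
    (hfπ : ∀ (x : V) (hx : {x}ᶜ ∈ 𝓕),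
      (f ⟨{x}ᶜ, hx⟩ : Set W) = symmDiff (f ⟨∅ᶜ, hempty⟩ : Set W) {π x})
    {R : Set V} (hfin : R.Finite) :
    ∀ x ∉ R, ∀ (hR : Rᶜ ∈ 𝓕) (hxR : (insert x R)ᶜ ∈ 𝓕),
      (f ⟨(insert x R)ᶜ, hxR⟩ : Set W) = symmDiff (f ⟨Rᶜ, hR⟩ : Set W) {π x} := by
  induction R, hfin using Set.Finite.induction_on with
  | empty =>
    intro x _ _ hx
    simpa only [insert_empty_eq] using hfπ x (by simpa only [insert_empty_eq] using hx)
  | @insert y R hyR _ ih =>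
    intro x hx hR' hxR'
    obtain ⟨hxy, hxR⟩ : x ≠ y ∧ x ∉ R := by simpa only [Set.mem_insert_iff, not_or] using hx
    have hy : y ∉ insert x R := by simp [hxy.symm, hyR]
    have hyx_mem : (insert y (insert x R))ᶜ ∈ 𝓕 := Set.insert_comm x y R ▸ hxR'
    have hx_mem : (insert x R)ᶜ ∈ 𝓕 :=
      h𝓕 (Set.compl_subset_compl.2 (Set.subset_insert y _)) hyx_mem
    have hR : Rᶜ ∈ 𝓕 := h𝓕 (Set.compl_subset_compl.2 (Set.subset_insert y R)) hR'
    -- Call the vertex in which its ends differ the label of an edge. In the image of the square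
    -- spanned by `x` and `y`, opposite edges have equal labels, and `ih` knows two adjacent labels.
    obtain ⟨t, ht⟩ := tarGraph_adj_iff.1 (f.map_adj (tarGraph_adj_compl_insert hx hR' hxR'))
    obtain ⟨z, hz⟩ := tarGraph_adj_iff.1 (f.map_adj (tarGraph_adj_compl_insert hy hx_mem hyx_mem))
    simp only [Set.insert_comm y x R] at hz
    rw [ih y hyR hR hR'] at ht ⊢
    rw [ih x hxR hR hx_mem] at hz
    refine (eq_or_eq_of_symmDiff_singleton_eq (hπ.ne hxy.symm) ht hz).resolve_left fun h => ?_
    have heq : (insert x (insert y R))ᶜ = Rᶜ := congrArg Subtype.val (hf (Subtype.ext h))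
    exact hxR (compl_injective heq ▸ Set.mem_insert x _)

theorem exists_injective_forall_map_eq_symmDiff_image [Finite V] (h𝓕 : IsUpperSet 𝓕)
    (hco : ∀ S : Set V, Sᶜ.Subsingleton → S ∈ 𝓕)
    {f : tarGraph 𝓕 →g tarGraph 𝓖} (hf : Function.Injective f) :
    ∃ (π : V → W) (A : Set W), Function.Injective π ∧
      ∀ S : 𝓕, (f S : Set W) = symmDiff A (π '' (S : Set V)ᶜ) := by
  have hempty : (∅ : Set V)ᶜ ∈ 𝓕 := hco _ (by simp)
  have hsingle (x : V) : {x}ᶜ ∈ 𝓕 := hco _ (by simp)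
  have hlabel (x : V) : ∃ y,
      (f ⟨{x}ᶜ, hsingle x⟩ : Set W) = symmDiff (f ⟨∅ᶜ, hempty⟩ : Set W) {y} := by
    have hadj := tarGraph_adj_compl_insert (Set.notMem_empty x) hempty
      (by simpa only [insert_empty_eq] using hsingle x)
    simpa only [insert_empty_eq] using tarGraph_adj_iff.1 (f.map_adj hadj)
  choose π hfπ using hlabel
  have hπ : Function.Injective π := by
    intro x y hxy
    have hval : (f ⟨{x}ᶜ, hsingle x⟩ : Set W) = f ⟨{y}ᶜ, hsingle y⟩ := by rw [hfπ, hfπ, hxy]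
    have hcompl : ({x} : Set V)ᶜ = {y}ᶜ := congrArg Subtype.val (hf (Subtype.ext hval))
    exact Set.singleton_injective (compl_injective hcompl)
  refine ⟨π, f ⟨∅ᶜ, hempty⟩, hπ, ?_⟩
  suffices hcompl : ∀ (R : Set V) (hR : Rᶜ ∈ 𝓕),
      (f ⟨Rᶜ, hR⟩ : Set W) = symmDiff (f ⟨∅ᶜ, hempty⟩ : Set W) (π '' R) by
    rintro ⟨S, hS⟩
    simpa only [compl_compl] using hcompl Sᶜ ((compl_compl S).symm ▸ hS)
  intro R
  induction R, R.toFinite using Set.Finite.induction_on with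
  | empty =>
    intro _
    rw [Set.image_empty]
    exact (symmDiff_bot _).symm
  | @insert x R hx _ ih =>
    intro hxR
    have hR : Rᶜ ∈ 𝓕 := h𝓕 (Set.compl_subset_compl.2 (Set.subset_insert x R)) hxR
    rw [map_compl_insert_eq_symmDiff_singleton h𝓕 hf hπ hempty (fun x _ => hfπ x) R.toFinite x hx
      hR, ih hR, symmDiff_assoc, symmDiff_singleton_of_notMem (by simpa [hπ.eq_iff] using hx),
      Set.image_insert_eq]

theorem eq_of_isUpperSet_of_symmDiff_mem_iff {α : Type u} [BooleanAlgebra α] {𝓐 𝓑 : Set α}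
    (h𝓐 : IsUpperSet 𝓐) (h𝓑 : IsUpperSet 𝓑) (d : α) (h : ∀ a, symmDiff a d ∈ 𝓑 ↔ a ∈ 𝓐) :
    𝓐 = 𝓑 := by
  ext a
  refine ⟨fun ha => ?_, fun ha => ?_⟩
  · have hsup : symmDiff (a ⊔ d) d ∈ 𝓑 := (h _).2 (h𝓐 le_sup_left ha)
    rw [symmDiff_of_ge le_sup_right, sup_sdiff_right_self] at hsup
    exact h𝓑 sdiff_le hsup
  · have hsdiff : symmDiff (a \ d) d ∈ 𝓑 := by
      rw [sdiff_symmDiff_eq_sup]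
      exact h𝓑 le_sup_left ha
    exact h𝓐 sdiff_le ((h _).1 hsdiff)

theorem exists_equiv_mem_iff_image_mem [Finite V] [Finite W] (h𝓕 : IsUpperSet 𝓕)
    (h𝓖 : IsUpperSet 𝓖) (hco𝓕 : ∀ S : Set V, Sᶜ.Subsingleton → S ∈ 𝓕)
    (hco𝓖 : ∀ S : Set W, Sᶜ.Subsingleton → S ∈ 𝓖) (φ : tarGraph 𝓕 ≃g tarGraph 𝓖) :
    ∃ e : V ≃ W, ∀ S : Set V, S ∈ 𝓕 ↔ e '' S ∈ 𝓖 := by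
  obtain ⟨π, A, hπ, hφ⟩ :=
    exists_injective_forall_map_eq_symmDiff_image h𝓕 hco𝓕 (f := φ.toHom) φ.injective
  obtain ⟨ρ, -, hρ, -⟩ :=
    exists_injective_forall_map_eq_symmDiff_image h𝓖 hco𝓖 (f := φ.symm.toHom) φ.symm.injective
  have hbij : Function.Bijective π :=
    hπ.bijective_of_nat_card_le (Nat.card_le_card_of_injective ρ hρ)
  have hφ' (S : 𝓕) : (φ S : Set W) = symmDiff (π '' S) Aᶜ := by
    rw [← compl_symmDiff_compl, compl_compl, ← Set.image_compl_eq hbij, symmDiff_comm]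
    exact hφ S
  have hpre : 𝓕 = Set.image π ⁻¹' 𝓖 := by
    refine eq_of_isUpperSet_of_symmDiff_mem_iff h𝓕
      (fun S T hST => h𝓖 (Set.image_mono hST)) (π ⁻¹' Aᶜ) fun S => ?_
    have himage : π '' symmDiff S (π ⁻¹' Aᶜ) = symmDiff (π '' S) Aᶜ := by
      rw [Set.image_symmDiff hπ, Set.image_preimage_eq _ hbij.surjective]
    rw [Set.mem_preimage, himage]
    refine ⟨fun hS => ?_, fun hS => hφ' ⟨S, hS⟩ ▸ (φ ⟨S, hS⟩).2⟩
    obtain ⟨T, hT⟩ := φ.surjective ⟨_, hS⟩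
    have hTS : π '' (T : Set V) = π '' S :=
      symmDiff_left_injective Aᶜ ((hφ' T).symm.trans (congrArg Subtype.val hT))
    exact hπ.image_injective hTS ▸ T.2
  exact ⟨.ofBijective π hbij, fun S => by rw [hpre]; rfl⟩

theorem exists_equiv_isPSDForcingSet_iff_image [Finite V] [Finite W] {G : SimpleGraph V}
    {H : SimpleGraph W} (hG : ∀ x, ¬ G.IsIsolated x) (hH : ∀ x, ¬ H.IsIsolated x)
    (φ : psdTARGraph G ≃g psdTARGraph H) :
    ∃ e : V ≃ W, ∀ S : Set V, IsPSDForcingSet G S ↔ IsPSDForcingSet H (e '' S) :=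
  exists_equiv_mem_iff_image_mem (𝓕 := {S | IsPSDForcingSet G S}) (𝓖 := {S | IsPSDForcingSet H S})
    (fun _ _ hST hS => IsPSDForcingSet.mono hS hST) (fun _ _ hST hS => IsPSDForcingSet.mono hS hST)
    (fun _ hS => isPSDForcingSet_of_isIndepSet_compl hG (hS.pairwise _))
    (fun _ hS => isPSDForcingSet_of_isIndepSet_compl hH (hS.pairwise _)) φ

end TAR

section CompleteBipartite

variable {V : Type u} {W : Type v} {G : SimpleGraph V} {H : SimpleGraph W} {A S : Set V}
  {a b i j k : V}

/-- `G` is the complete bipartite graph whose two parts are `A` and its complement; either part may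
be empty. -/
def IsCompleteBipartition (G : SimpleGraph V) (A : Set V) : Prop :=
  ∀ x y, G.Adj x y ↔ (x ∈ A ↔ y ∉ A)

theorem IsCompleteBipartition.nonempty_iso [Finite V] [Finite W] {B : Set W}
    (hG : IsCompleteBipartition G A) (hH : IsCompleteBipartition H B)
    (hA : A.ncard = B.ncard) (hAc : Aᶜ.ncard = Bᶜ.ncard) : Nonempty (G ≃g H) := by
  classical
  obtain ⟨eA⟩ := Finite.card_eq.1 (show Nat.card A = Nat.card B from hA)
  obtain ⟨eAc⟩ := Finite.card_eq.1 (show Nat.card ↥Aᶜ = Nat.card ↥Bᶜ from hAc)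
  let e : V ≃ W :=
    (Equiv.Set.sumCompl A).symm.trans ((eA.sumCongr eAc).trans (Equiv.Set.sumCompl B))
  have he (x : V) : e x ∈ B ↔ x ∈ A := by
    by_cases hx : x ∈ A
    · simp [e, hx, Equiv.Set.sumCompl_symm_apply_of_mem]
    · have hmem : ((eAc ⟨x, hx⟩ : ↥Bᶜ) : W) ∉ B := (eAc ⟨x, hx⟩).2
      simp [e, hx, hmem, Equiv.Set.sumCompl_symm_apply_of_notMem]
  exact ⟨e, fun {x y} => by rw [hG, hH, he, he]⟩

theorem IsCompleteBipartition.compl (hG : IsCompleteBipartition G A) :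
    IsCompleteBipartition G Aᶜ := by
  intro x y
  rw [hG x y, Set.mem_compl_iff, Set.mem_compl_iff, not_iff_not, iff_not_comm, iff_comm]

theorem IsCompleteBipartition.adj (hG : IsCompleteBipartition G A) {x y : V} (hx : x ∈ A)
    (hy : y ∉ A) : G.Adj x y :=
  (hG x y).2 (iff_of_true hx hy)

theorem IsCompleteBipartition.isIndepSet (hG : IsCompleteBipartition G A) : G.IsIndepSet A :=
  fun x hx y hy _ hxy => ((hG x y).1 hxy).1 hx hy

theorem IsCompleteBipartition.not_isIsolated (hG : IsCompleteBipartition G A) (hA : A.Nonempty)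
    (hAc : Aᶜ.Nonempty) (x : V) : ¬ G.IsIsolated x := by
  rw [← SimpleGraph.exists_adj_iff_not_isIsolated]
  by_cases hx : x ∈ A
  · exact hAc.imp fun y hy => hG.adj hx hy
  · exact hA.imp fun y hy => (hG.adj hy hx).symm

theorem IsCompleteBipartition.not_isPSDForcingSet_of_ssubset_compl
    (hG : IsCompleteBipartition G A) (hA : A.Nontrivial) (hS : S ⊂ Aᶜ) :
    ¬ IsPSDForcingSet G S := by
  intro hforcing
  obtain ⟨x, hxA, hxS⟩ := Set.exists_of_ssubset hS
  have hdisj : Disjoint S (insert x A) :=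
    Set.disjoint_insert_right.2 ⟨hxS, Set.subset_compl_iff_disjoint_right.1 hS.subset⟩
  have hconn : (G.induce (insert x A)).Connected :=
    connected_induce_of_forall_adj (Set.mem_insert x A) fun y hy hyx =>
      (hG.adj (hy.resolve_left hyx) hxA).symm
  obtain ⟨u, hu, w, -, hunique⟩ := hforcing.exists_existsUnique_adj hdisj hconn
  have huA : u ∉ A := fun h => hu (.inr h)
  obtain ⟨y, hy, hyw⟩ := hA.exists_ne w
  exact hyw (hunique y ⟨.inr hy, (hG.adj hy huA).symm⟩)

theorem IsCompleteBipartition.isPSDForcingSet_of_subset [Finite V]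
    (hG : IsCompleteBipartition G A) (hA : A.Nonempty) (hAc : Aᶜ.Nonempty) (hAS : A ⊆ S) :
    IsPSDForcingSet G S :=
  isPSDForcingSet_of_isIndepSet_compl (hG.not_isIsolated hA hAc)
    (hG.compl.isIndepSet.mono (Set.compl_subset_compl.2 hAS))

theorem IsCompleteBipartition.isPSDForcingSet_of_subsingleton_diff [Finite V]
    (hG : IsCompleteBipartition G A) (hA : A.Nonempty) (hS : (S \ A).Nonempty)
    (hAS : (A \ S).Subsingleton) : IsPSDForcingSet G S := by
  obtain ⟨i, hiS, hiA⟩ := hS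
  by_cases hsub : A ⊆ S
  · exact hG.isPSDForcingSet_of_subset hA ⟨i, hiA⟩ hsub
  · obtain ⟨b, hbA, hbS⟩ := Set.not_subset.1 hsub
    have hforce : PSDForces G S i b :=
      psdForces_of_forall_adj_eq hiS (hG.adj hbA hiA).symm hbS fun x hxS hix =>
        hAS ⟨not_not.1 (mt ((hG i x).1 hix).2 hiA), hxS⟩ ⟨hbA, hbS⟩
    refine hforce.isPSDForcingSet (hG.isPSDForcingSet_of_subset hA ⟨i, hiA⟩ fun x hx => ?_)
    by_cases hxS : x ∈ S
    · exact .inr hxS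
    · exact .inl (hAS ⟨hx, hxS⟩ ⟨hbA, hbS⟩)

/-- The vertex partition into `A` and its complement is a PSD forcing bipartition of `G` if the sets
that are not PSD forcing are exactly the proper subsets of the two parts. Unlike
`IsCompleteBipartition`, this depends only on the forcing sets, so it can be carried over along an
isomorphism of TAR graphs. -/
def IsPSDForcingBipartition (G : SimpleGraph V) (A : Set V) : Prop :=
  ∀ S, ¬ IsPSDForcingSet G S ↔ S ⊂ A ∨ S ⊂ Aᶜ

theorem IsCompleteBipartition.isPSDForcingBipartition [Finite V]
    (hG : IsCompleteBipartition G A) (hA : A.ncard = 2) (hAc : Aᶜ.Nontrivial) :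
    IsPSDForcingBipartition G A := by
  intro S
  have hA' : A.Nontrivial := Set.one_lt_ncard_iff_nontrivial.1 (hA ▸ Nat.one_lt_two)
  refine ⟨fun hS => ?_, ?_⟩
  · have hAS : ¬ A ⊆ S := mt (hG.isPSDForcingSet_of_subset hA'.nonempty hAc.nonempty) hS
    have hAcS : ¬ Aᶜ ⊆ S := mt (hG.compl.isPSDForcingSet_of_subset hAc.nonempty
      (by rw [compl_compl]; exact hA'.nonempty)) hS
    by_contra! hsub
    obtain ⟨i, hi⟩ := Set.not_subset.1 fun h => hsub.1 ⟨h, hAS⟩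
    obtain ⟨a, haS, haA⟩ := Set.not_subset.1 fun h => hsub.2 ⟨h, hAcS⟩
    refine hS (hG.isPSDForcingSet_of_subsingleton_diff hA'.nonempty ⟨i, hi⟩ ?_)
    have hAa : (A \ {a}).ncard = 1 := by
      rw [Set.ncard_sdiff_singleton_of_mem (not_not.1 haA), hA]
    obtain ⟨b, hb⟩ := Set.ncard_eq_one.1 hAa
    exact Set.subsingleton_singleton.anti
      (hb ▸ Set.sdiff_subset_sdiff_right (Set.singleton_subset_iff.2 haS))
  · rintro (h | h)
    · exact hG.compl.not_isPSDForcingSet_of_ssubset_compl hAc (by rwa [compl_compl])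
    · exact hG.not_isPSDForcingSet_of_ssubset_compl hA' h

theorem IsPSDForcingBipartition.compl (h : IsPSDForcingBipartition G A) :
    IsPSDForcingBipartition G Aᶜ := by
  intro S
  rw [h S, compl_compl, or_comm]

theorem IsPSDForcingBipartition.isPSDForcingSet_of_mem (h : IsPSDForcingBipartition G A) {x y : V}
    (hx : x ∈ S) (hxA : x ∈ A) (hy : y ∈ S) (hyA : y ∉ A) : IsPSDForcingSet G S :=
  not_not.1 fun hS => ((h S).1 hS).elim (fun hSA => hyA (hSA.subset hy))
    fun hSA => hSA.subset hx hxA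

theorem IsPSDForcingBipartition.isPSDForcingSet (h : IsPSDForcingBipartition G A)
    (hA : A.Nonempty) : IsPSDForcingSet G A := by
  obtain ⟨x, hx⟩ := hA
  exact not_not.1 fun hS => ((h A).1 hS).elim (fun hAA => hAA.ne rfl)
    fun hAA => hAA.subset hx hx

theorem IsPSDForcingBipartition.isPSDFort_insert (h : IsPSDForcingBipartition G A)
    (hAc : Aᶜ.Nontrivial) (hk : k ∉ A) : IsPSDFort G (insert k A) := by
  have hcompl : (insert k A)ᶜ = Aᶜ \ {k} := by
    rw [← Set.union_singleton, Set.compl_union, Set.sdiff_eq]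
  rw [← compl_compl (insert k A), hcompl]
  refine isPSDFort_compl_of_maximal ⟨(h _).2 (.inr ?_), fun T hT hle => ?_⟩
  · exact Set.sdiff_singleton_ssubset.2 hk
  · rcases (h T).1 hT with hTA | hTA
    · obtain ⟨x, hx, hxk⟩ := hAc.exists_ne k
      exact absurd (hTA.subset (hle ⟨hx, hxk⟩)) hx
    · refine fun x hx => ⟨hTA.subset hx, fun hxk => hTA.not_subset fun y hy => ?_⟩
      by_cases hyk : y = k
      · exact hyk.trans hxk.symm ▸ hx
      · exact hle ⟨hy, hyk⟩

theorem isIndepSet_compl_of_isPSDForcingSet (hA : IsPSDForcingSet G A)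
    (hadj : ∀ x ∈ A, ∀ y ∉ A, G.Adj x y) : G.IsIndepSet Aᶜ := by
  intro x hx y hy _ hxy
  -- The non-isolated vertices of `G[V ∖ A]` form a fort.
  let F : Set V := {z | z ∉ A ∧ ∃ t ∉ A, G.Adj z t}
  have hF : IsPSDFort G F := by
    refine ⟨⟨x, hx, y, hy, hxy⟩, fun u w hf => ?_⟩
    obtain ⟨hw, t, ht, hwt⟩ := not_not.1 hf.notMem
    by_cases hu : u ∈ A
    · exact hf.not_adj (not_not.2 ⟨ht, w, hw, hwt.symm⟩) (hadj u hu t ht) hwt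
    · exact hf.1 ⟨hu, w, hw, hf.2.1⟩
  exact hA.not_disjoint_fort hF (Set.disjoint_left.2 fun z hz hzF => hzF.1 hz)

theorem isCompleteBipartition_of_forall_isPSDFort_insert (hG : ∀ x, ¬ G.IsIsolated x)
    (hindep : G.IsIndepSet A) (hfort : ∀ k ∉ A, IsPSDFort G (insert k A))
    (hA : IsPSDForcingSet G A) : IsCompleteBipartition G A := by
  have hadj : ∀ x ∈ A, ∀ y ∉ A, G.Adj x y := by
    intro x hx y hy
    obtain ⟨z, rfl | hz, hxz⟩ := (hfort y hy).exists_adj (.inr hx) (hG x)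
    · exact hxz
    · exact absurd hxz (hindep hx hz hxz.ne)
  have hindep' := isIndepSet_compl_of_isPSDForcingSet hA hadj
  intro x y
  by_cases hx : x ∈ A <;> by_cases hy : y ∈ A
  · simpa [hx, hy] using fun hxy : G.Adj x y => hindep hx hy hxy.ne hxy
  · simpa [hx, hy] using hadj x hx y hy
  · simpa [hx, hy] using (hadj y hy x hx).symm
  · simpa [hx, hy] using fun hxy : G.Adj x y => hindep' hx hy hxy.ne hxy

theorem IsPSDForcingBipartition.adj_or_adj (h : IsPSDForcingBipartition G {a, b})
    (hQ : ({a, b} : Set V)ᶜ.Nontrivial) (hG : ∀ x, ¬ G.IsIsolated x) (hk : k ∉ ({a, b} : Set V)) :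
    G.Adj k a ∨ G.Adj k b := by
  obtain ⟨x, rfl | rfl | rfl, hkx⟩ :=
    (h.isPSDFort_insert hQ hk).exists_adj (Set.mem_insert k _) (hG k)
  · exact absurd rfl hkx.ne
  · exact .inl hkx
  · exact .inr hkx

theorem IsPSDForcingBipartition.adj_of_not_adj (h : IsPSDForcingBipartition G {a, b})
    (hQ : ({a, b} : Set V)ᶜ.Nontrivial) (hG : ∀ x, ¬ G.IsIsolated x) (hi : i ∉ ({a, b} : Set V))
    (hib : ¬ G.Adj i b) (hk : k ∉ ({a, b} : Set V)) (hki : k ≠ i) : G.Adj i k := by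
  have hia : G.Adj i a := (h.adj_or_adj hQ hG hi).resolve_right hib
  obtain ⟨x, rfl | rfl | rfl, hxa, hix⟩ := (h.isPSDFort_insert hQ hk).exists_ne_adj
    (by simpa [hki.symm] using hi) (.inr (.inl rfl)) hia
  · exact hix
  · exact absurd rfl hxa
  · exact absurd hix hib

theorem IsPSDForcingBipartition.connected_induce_compl (h : IsPSDForcingBipartition G {a, b})
    (hQ : ({a, b} : Set V)ᶜ.Nontrivial) (hG : ∀ x, ¬ G.IsIsolated x) (hab : G.Adj a b) :
    (G.induce ({a, b} : Set V)ᶜ).Connected := by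
  obtain ⟨u, hu, w, -, hunique⟩ :=
    (h.compl.isPSDForcingSet hQ.nonempty).exists_existsUnique_adj disjoint_compl_left
      (SimpleGraph.induce_pair_connected_of_adj hab)
  refine connected_induce_of_forall_adj hu fun x hx hxu => ?_
  by_cases hub : G.Adj u b
  · have hua : ¬ G.Adj u a := fun hua =>
      hab.ne ((hunique a ⟨.inl rfl, hua⟩).trans (hunique b ⟨.inr rfl, hub⟩).symm)
    rw [Set.pair_comm] at h hQ hu hx
    exact h.adj_of_not_adj hQ hG hu hua hx hxu
  · exact h.adj_of_not_adj hQ hG hu hub hx hxu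

theorem IsPSDForcingBipartition.compl_eq_pair_of_forall_adj_eq
    (h : IsPSDForcingBipartition G {a, b}) (hQ : ({a, b} : Set V)ᶜ.Nontrivial)
    (hG : ∀ x, ¬ G.IsIsolated x) (hab : G.Adj a b)
    (hi : i ∉ ({a, b} : Set V)) (hj : j ∉ ({a, b} : Set V)) (hij : i ≠ j) (hbj : G.Adj b j)
    (hunique : ∀ x ∉ ({a, b} : Set V), G.Adj b x → x = j) : ({a, b} : Set V)ᶜ = {i, j} := by
  have hbi : ¬ G.Adj b i := fun hbi => hij (hunique i hi hbi)
  have hia : G.Adj i a := (h.adj_or_adj hQ hG hi).resolve_right fun hib => hbi hib.symm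
  have hforcing : IsPSDForcingSet G {b, i} :=
    h.isPSDForcingSet_of_mem (.inl rfl) (.inr rfl) (.inr rfl) hi
  -- A vertex `l ≠ i, j` outside `{a, b}` would be adjacent to all of `{b, i}ᶜ`, whereas `b` is
  -- adjacent to `a` and `j`, and `i` to `a` and `l`, so nothing could be forced from `{b, i}`.
  refine Set.Subset.antisymm (fun l hl => ?_) (Set.pair_subset hi hj)
  by_contra hlij
  obtain ⟨hli, hlj⟩ : l ≠ i ∧ l ≠ j := by simpa using hlij
  have hlb : ¬ G.Adj l b := fun hlb => hlj (hunique l hl hlb.symm)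
  have hla : G.Adj l a := (h.adj_or_adj hQ hG hl).resolve_right hlb
  have hlF : l ∈ ({b, i} : Set V)ᶜ := by simp_all
  have haF : a ∈ ({b, i} : Set V)ᶜ := by simp [hab.ne, hia.ne']
  have hjF : j ∈ ({b, i} : Set V)ᶜ := by simp [hbj.ne', hij.symm]
  have hconn : (G.induce ({b, i} : Set V)ᶜ).Connected := by
    refine connected_induce_of_forall_adj hlF fun x hx hxl => ?_
    by_cases hxa : x = a
    · exact hxa ▸ hla
    · exact h.adj_of_not_adj hQ hG hl hlb (by simp_all) hxl
  obtain ⟨u, hu, w, -, huw⟩ := hforcing.exists_existsUnique_adj disjoint_compl_right hconn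
  obtain rfl | rfl := not_not.1 hu
  · have haj : a = j := (huw a ⟨haF, hab.symm⟩).trans (huw j ⟨hjF, hbj⟩).symm
    exact hj (haj ▸ .inl rfl)
  · have hul : G.Adj u l := h.adj_of_not_adj hQ hG hi (fun hub => hbi hub.symm) hl hli
    exact hla.ne ((huw l ⟨hlF, hul⟩).trans (huw a ⟨haF, hia⟩).symm)

-- Here `G` is a 4-cycle and `{a, b}` one of its edges, so the part `A` cannot be `{a, b}` itself.
theorem IsPSDForcingBipartition.exists_isCompleteBipartition_of_adj
    (h : IsPSDForcingBipartition G {a, b}) (hQ : ({a, b} : Set V)ᶜ.Nontrivial)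
    (hG : ∀ x, ¬ G.IsIsolated x) (hab : G.Adj a b) :
    ∃ A : Set V, A.ncard = 2 ∧ IsCompleteBipartition G A := by
  obtain ⟨u, hu, j, ⟨hj, huj⟩, hunique⟩ :=
    (h.isPSDForcingSet ⟨a, .inl rfl⟩).exists_existsUnique_adj disjoint_compl_right
      (h.connected_induce_compl hQ hG hab)
  wlog hub : u = b generalizing a b
  · obtain rfl : u = a := (not_not.1 hu).resolve_right hub
    rw [Set.pair_comm] at h hQ hu hj hunique
    exact this h hQ hab.symm hu hunique hj rfl
  subst hub
  obtain ⟨i, hi, hij⟩ := hQ.exists_ne j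
  have hui : ¬ G.Adj u i := fun hui => hij (hunique i ⟨hi, hui⟩)
  have hne : u ≠ i := fun hui => hi (.inr hui.symm)
  have hcompl : ({a, u} : Set V)ᶜ = {i, j} :=
    h.compl_eq_pair_of_forall_adj_eq hQ hG hab hi hj hij huj fun x hx hux => hunique x ⟨hx, hux⟩
  refine ⟨{u, i}, Set.ncard_pair hne, isCompleteBipartition_of_forall_isPSDFort_insert hG ?_ ?_
    (h.isPSDForcingSet_of_mem (.inl rfl) (.inr rfl) (.inr rfl) hi)⟩
  · exact Set.pairwise_pair.2 fun _ => ⟨hui, fun hiu => hui hiu.symm⟩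
  · intro k hk
    by_cases hkA : k ∈ ({a, u} : Set V)
    · obtain rfl : k = a := hkA.resolve_right fun hku => hk (.inl hku)
      convert h.isPSDFort_insert hQ hi using 1
      rw [Set.pair_comm u i, Set.insert_comm]
    · obtain rfl : k = j :=
        (hcompl.subset hkA).resolve_left fun hki => hk (.inr hki)
      have hAcc : ({a, u} : Set V)ᶜᶜ.Nontrivial := by
        rw [compl_compl]
        exact Set.nontrivial_pair hab.ne
      convert h.compl.isPSDFort_insert hAcc (k := u) (not_not.2 (.inr rfl)) using 1
      rw [hcompl, Set.pair_comm i k, Set.insert_comm]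

theorem IsPSDForcingBipartition.exists_isCompleteBipartition (h : IsPSDForcingBipartition G A)
    (hA : A.ncard = 2) (hAc : Aᶜ.Nontrivial) (hG : ∀ x, ¬ G.IsIsolated x) :
    ∃ A' : Set V, A'.ncard = 2 ∧ IsCompleteBipartition G A' := by
  obtain ⟨a, b, -, rfl⟩ := Set.ncard_eq_two.1 hA
  by_cases hadj : G.Adj a b
  · exact h.exists_isCompleteBipartition_of_adj hAc hG hadj
  · refine ⟨{a, b}, hA, isCompleteBipartition_of_forall_isPSDFort_insert hG ?_
      (fun k hk => h.isPSDFort_insert hAc hk) (h.isPSDForcingSet ⟨a, .inl rfl⟩)⟩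
    exact Set.pairwise_pair.2 fun _ => ⟨hadj, fun hba => hadj hba.symm⟩

theorem IsPSDForcingBipartition.preimage {B : Set W} (h : IsPSDForcingBipartition H B)
    (e : V ≃ W) (he : ∀ S, IsPSDForcingSet G S ↔ IsPSDForcingSet H (e '' S)) :
    IsPSDForcingBipartition G (e ⁻¹' B) := by
  have himage (S : Set V) (C : Set W) : S ⊂ e ⁻¹' C ↔ e '' S ⊂ C := by
    rw [← e.injective.injOn.image_ssubset_image_iff (Set.subset_univ _) (Set.subset_univ _),
      e.image_preimage]
  intro S
  rw [he, h, himage, ← Set.preimage_compl, himage]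

end CompleteBipartite

theorem isCompleteBipartition_completeBipartiteGraph (α : Type u) (β : Type v) :
    IsCompleteBipartition (completeBipartiteGraph α β) (Set.range Sum.inl) := by
  rintro (x | x) (y | y) <;> simp

theorem propositionp (q : ℕ) (hq : 2 ≤ q) :
    HasUniquePSDTARGraph.{u} (completeBipartiteGraph (Fin 2) (Fin q)) := by
  have : Nontrivial (Fin q) := Fin.nontrivial_iff_two_le.2 hq
  set B : Set (Fin 2 ⊕ Fin q) := Set.range Sum.inl
  have hB : B.ncard = 2 := by simp [B, Set.ncard_range_of_injective Sum.inl_injective]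
  have hBc : Bᶜ.Nontrivial := by
    rw [Set.compl_range_inl, ← Set.image_univ]
    exact Set.nontrivial_univ.image Sum.inr_injective
  have hK : IsCompleteBipartition (completeBipartiteGraph (Fin 2) (Fin q)) B :=
    isCompleteBipartition_completeBipartiteGraph (Fin 2) (Fin q)
  have hKiso := hK.not_isIsolated (Set.range_nonempty _) hBc.nonempty
  refine ⟨hKiso, fun V _ G hG ⟨φ⟩ => ?_⟩
  obtain ⟨e, he⟩ := exists_equiv_isPSDForcingSet_iff_image hG hKiso φ
  have hpre : (e ⁻¹' B).ncard = 2 := by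
    rw [Set.ncard_preimage_of_injective_subset_range e.injective (by simp), hB]
  have hbip : IsPSDForcingBipartition G (e ⁻¹' B) :=
    (hK.isPSDForcingBipartition hB hBc).preimage e he
  obtain ⟨A, hA, hGA⟩ := hbip.exists_isCompleteBipartition hpre (hBc.preimage e.surjective) hG
  refine hGA.nonempty_iso hK (hA.trans hB.symm) ?_
  rw [Set.ncard_compl, Set.ncard_compl, hA, hB, Nat.card_congr e]
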